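/- **Conventions.** Let $\Sigma$ be a finite alphabet. A deterministic parity automaton (DPA) $\mathcal A=(Q,\Sigma,\delta,q_0)$ has a finite set $Q$ of states, an initial state $q_0$, and for every $q\in Q$, $x\in\Sigma$ exactly one transition, leading to a state and carrying a color in $\mathbb N$. The *dominating color* of a run is the least color that occurs infinitely often along it. $\mathcal L(\mathcal A)\subseteq\Sigma^\omega$ is the set of words whose run has an even dominating color. $\mathcal A_q$ is $\mathcal A$ with initial state $q$, and $q\sim_{\mathcal A}q'$ means $\mathcal L(\mathcal A_q)=\mathcal L(\mathcal A_{q'})$. $\mathcal A$ is *structured* if all states are reachable and equivalent states lie in the same maximal strongly connected component (SCC). **Streamlining.** The *streamlined version* of a structured DPA has the same structure and the colors produced by the following process. Start with $i=0$ and with a copy $\mathcal G$ of the transition graph; until $\mathcal G$ is empty, repeat: (1) partition $\mathcal G$ into maximal SCCs; (2) give color $i$ to all transitions that can be taken at most once along a path in $\mathcal G$, and remove these transitions and the states that can be visited at most once; (3) for every SCC of $\mathcal G$ in which the least color of the transitions between its states has the same parity as $i$, give color $i$ to its transitions of that least color and remove them from $\mathcal G$; if there is no such SCC, increment $i$. A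 DPA is *streamlined* if it is the streamlined version of a structured DPA. **Natural color.** Let $L\subseteq\Sigma^\omega$. A finite word $u$ is *suffix language invariant* for $L$ after a finite word $v$ if $\{x\in\Sigma^\omega : vx\in L\}=\{x\in\Sigma^\omega : vux\in L\}$. A word $w'$ is the result of a *suffix language invariant injection* of finite words $u_0,u_1,\dots$ into $w=w_0w_1\cdots$ at positions $J=\{i_0<i_1<\cdots\}$ if $w'=w_0\cdots w_{i_0}\,u_0\,w_{i_0+1}\cdots w_{i_1}\,u_1\,w_{i_1+1}\cdots$ and each $u_j$ is suffix language invariant for $L$ after $w_0\cdots w_{i_j}$. Recursively over $i\in\mathbb N$, $w$ is *at home in color $i$* for $L$ if there is an infinite $J\subseteq\mathbb N$ such that every result $w'$ of a suffix language invariant injection into $w$ at the positions $J$ satisfies: $w'$ is at home in some color $<i$; or $w,w'\in L$ and $i$ is even; or $w,w'\notin L$ and $i$ is odd. The *natural color* of $w$ for $L$ is the least color in which $w$ is at home for $L$. **Co-runs.** Let $q_0q_1q_2\cdots$ be the run of a DPA $\mathcal A$ on $w$. A *co-run* of $\mathcal A$ on $w$ is a sequence $q_0\cdots q_p\,q'_{p+1}q'_{p+2}\cdots$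 with $p>0$ such that, for some state $q'_p\sim_{\mathcal A}q_p$, the sequence $q'_pq'_{p+1}q'_{p+2}\cdots$ is the run of $\mathcal A_{q'_p}$ on $w_pw_{p+1}\cdots$; its colors are those of the first $p$ transitions of the run of $\mathcal A$ on $w$, followed by those of this run of $\mathcal A_{q'_p}$. The *color of the set of co-runs* of $w$ is the maximal dominating color of a co-run of $\mathcal A$ on $w$. **Statement.** Let $\mathcal A$ be a streamlined DPA. For every word $w\in\Sigma^\omega$, the color of the set of co-runs of $\mathcal A$ on $w$ and the natural color of $w$ for $\mathcal L(\mathcal A)$ both exist, and they are equal. -/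

import Mathlib

/-! ## Infinite words over an alphabet `α` are streams `Stream' α` -/

namespace NaturalColor

open Filter

/-- The colors that occur infinitely often in a color sequence. -/
def infColors (ρ : ℕ → ℕ) : Set ℕ := {c | ∃ᶠ k in atTop, ρ k = c}

/-- `c` is the dominating color of `ρ`: the least color occurring infinitely often. -/
def IsDominatingColor (ρ : ℕ → ℕ) (c : ℕ) : Prop := IsLeast (infColors ρ) c

/-! ### Languages: suffix languages, injections, natural colors -/

section Language

variable {α : Type*}

/-- The suffix language `{w' | u w' ∈ L}` of `L` over the finite word `u`. -/
def suffixLanguage (L : Set (Stream' α)) (u : List α) : Set (Stream' α) :=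
  {w' | u ++ₛ w' ∈ L}

/-- The finite word `v` is suffix language invariant for `L` after the finite word `u`. -/
def SuffixInvariant (L : Set (Stream' α)) (u v : List α) : Prop :=
  suffixLanguage L u = suffixLanguage L (u ++ v)

/-- The finite word `w₀ u₀ w₁ u₁ … w₍ₙ₋₁₎ u₍ₙ₋₁₎`. -/
def interleave (w : Stream' α) (u : ℕ → List α) (n : ℕ) : List α :=
  (List.range n).flatMap fun k => w.get k :: u k

/-- `w'` is the result of a suffix language invariant injection into `w` at the positions in `J`.
The finite words are indexed by the positions themselves: `u k` is inserted directly after the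
letter `w_k`; nothing is inserted at positions outside `J`. -/
structure IsInjection (L : Set (Stream' α)) (w : Stream' α) (J : Set ℕ) (u : ℕ → List α)
    (w' : Stream' α) : Prop where
  eq_nil : ∀ k, k ∉ J → u k = []
  invariant : ∀ k ∈ J, SuffixInvariant L (w.take (k + 1)) (u k)
  result : ∀ n, w'.take (interleave w u n).length = interleave w u n

/-- `w` is at home in color `i` for `L` (by recursion on `i`). -/
def AtHome (L : Set (Stream' α)) (i : ℕ) (w : Stream' α) : Prop :=
  ∃ J : Set ℕ, J.Infinite ∧ ∀ (u : ℕ → List α) (w' : Stream' α), IsInjection L w J u w' →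
    (∃ k, ∃ _ : k < i, AtHome L k w') ∨
      ((w ∈ L ∧ w' ∈ L ∧ Even i) ∨ (w ∉ L ∧ w' ∉ L ∧ Odd i))
termination_by i

/-- `c` is the natural color of `w` for `L`: the least color in which `w` is at home. -/
def IsNaturalColor (L : Set (Stream' α)) (w : Stream' α) (c : ℕ) : Prop :=
  IsLeast {i | AtHome L i w} c

end Language

/-! ### Deterministic parity automata with transition-based (min-even) acceptance -/

/-- A deterministic, complete parity automaton. The transition leaving `q` under the letter `x`
leads to `step q x` and has color `color q x`; it is identified with the pair `(q, x)`. -/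
structure DPA (α Q : Type*) where
  step : Q → α → Q
  color : Q → α → ℕ
  start : Q

namespace DPA

variable {α Q : Type*}

/-- The state sequence of the run of `A_q` on `w`. -/
def run (A : DPA α Q) (q : Q) (w : Stream' α) : ℕ → Q
  | 0 => q
  | n + 1 => A.step (A.run q w n) (w.get n)

/-- The color sequence of the run of `A_q` on `w`. -/
def runColor (A : DPA α Q) (q : Q) (w : Stream' α) (n : ℕ) : ℕ :=
  A.color (A.run q w n) (w.get n)

/-- The language of `A_q`. -/
def languageFrom (A : DPA α Q) (q : Q) : Set (Stream' α) :=
  {w | ∃ c, IsDominatingColor (A.runColor q w) c ∧ Even c}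

/-- The language of `A`. -/
def language (A : DPA α Q) : Set (Stream' α) := A.languageFrom A.start

/-- Language equivalence of states. -/
def Equivalent (A : DPA α Q) (q r : Q) : Prop := A.languageFrom q = A.languageFrom r

/-- `r` is reachable from `q` using (finitely many, possibly no) transitions from `G`. -/
def Reach (A : DPA α Q) (G : Set (Q × α)) : Q → Q → Prop :=
  Relation.ReflTransGen fun q r => ∃ x, (q, x) ∈ G ∧ A.step q x = r

/-- `q` and `r` are in the same maximal strongly connected component of the graph `G`. -/
def SameSCC (A : DPA α Q) (G : Set (Q × α)) (q r : Q) : Prop :=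
  A.Reach G q r ∧ A.Reach G r q

/-- All states are reachable, and equivalent states are in the same maximal SCC. -/
structure IsStructured (A : DPA α Q) : Prop where
  reachable : ∀ q, A.Reach Set.univ A.start q
  sameSCC : ∀ q r, A.Equivalent q r → A.SameSCC Set.univ q r

/-! ### Streamlining -/

/-- The transitions of `G` that can be taken at most once along a path in `G`. -/
def transient (A : DPA α Q) (G : Set (Q × α)) : Set (Q × α) :=
  {t ∈ G | ¬ A.Reach G (A.step t.1 t.2) t.1}

/-- The transitions of `G` inside a maximal SCC of `G` that have the least color among all
transitions of `G` between states of that SCC. -/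
def leastInSCC (A : DPA α Q) (G : Set (Q × α)) (col : Q → α → ℕ) : Set (Q × α) :=
  {t ∈ G | A.SameSCC G t.1 (A.step t.1 t.2) ∧
    ∀ s ∈ G, A.SameSCC G t.1 s.1 → A.SameSCC G t.1 (A.step s.1 s.2) →
      col t.1 t.2 ≤ col s.1 s.2}

/-- A configuration of the streamlining process: the counter `i`, the transitions that remain in
the coloring graph, and the current coloring of the automaton. (States without remaining
transitions play no role for the coloring, so that only the transitions are recorded.) -/
structure StreamlineConfig (α Q : Type*) where
  i : ℕ
  graph : Set (Q × α)
  col : Q → α → ℕ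

open Classical in
/-- One pass through the loop of the streamlining process. The transient transitions `T` get color
`i` and are removed. Then, the transitions `M` of least color in their SCC whose color has the
same parity as `i` get color `i` and are removed; if there are none, `i` is incremented. -/
noncomputable def streamlinePass (A : DPA α Q) (s : StreamlineConfig α Q) :
    StreamlineConfig α Q :=
  let T := A.transient s.graph
  let G := s.graph \ T
  let M := {t ∈ A.leastInSCC G s.col | s.col t.1 t.2 % 2 = s.i % 2}
  { i := if M.Nonempty then s.i else s.i + 1
    graph := G \ M
    col := fun q x => if (q, x) ∈ T ∪ M then s.i else s.col q x }

/-- The configuration after `n` passes, starting with `i = 0`, all transitions, and the given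
coloring. -/
noncomputable def streamlineConfig (A : DPA α Q) (n : ℕ) : StreamlineConfig α Q :=
  A.streamlinePass^[n] ⟨0, Set.univ, A.color⟩

/-- `A` is the streamlined version of `B`: the streamlining process started on `B` arrives at the
empty graph with the coloring of `A`; the structure is that of `B`. (Passes made on the empty graph
leave the coloring unchanged, so that the choice of `n` is immaterial.) -/
def IsStreamlinedVersion (A B : DPA α Q) : Prop :=
  ∃ n, (B.streamlineConfig n).graph = ∅ ∧ A = { B with color := (B.streamlineConfig n).col }

/-- `A` is streamlined: it is the streamlined version of some structured DPA. -/
def IsStreamlined (A : DPA α Q) : Prop := ∃ B : DPA α Q, B.IsStructured ∧ A.IsStreamlinedVersion B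

/-! ### Co-runs -/

/-- `π` is a co-run of `A` on `w`, with color sequence `ρ`: for some `p > 0`, it follows the run
`q₀ q₁ …` of `A` on `w` up to `q_p`, and from then on it follows the run of `A_{q'}` on
`w_p w_{p+1} …` for some state `q'` that is equivalent to `q_p`. -/
def IsCoRun (A : DPA α Q) (w : Stream' α) (π : ℕ → Q) (ρ : ℕ → ℕ) : Prop :=
  ∃ p > 0, ∃ q', A.Equivalent q' (A.run A.start w p) ∧
    (∀ k ≤ p, π k = A.run A.start w k) ∧
    (∀ k > 0, π (p + k) = A.run q' (w.drop p) k) ∧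
    (∀ k < p, ρ k = A.runColor A.start w k) ∧
    (∀ k, ρ (p + k) = A.runColor q' (w.drop p) k)

/-- `c` is the color of the set of co-runs of `A` on `w`: the maximal dominating color. -/
def IsCoRunColor (A : DPA α Q) (w : Stream' α) (c : ℕ) : Prop :=
  IsGreatest {d | ∃ π ρ, A.IsCoRun w π ρ ∧ IsDominatingColor ρ d} c

end DPA

end NaturalColor

/-!
For a word `w` let `c(w)` be the largest dominating color of a co-run on `w`. All co-runs on `w`
have dominating colors of the same parity, which is even exactly if `w` is in the language.

The only property of streamlined automata that is needed is `IsStreamlined.exists_cycle`: if a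
transition leaving `q` has a color of at least `m ≥ 1`, then some cycle through `q` has least
color exactly `m`. When the counter of the streamlining process reaches `m`, the remaining
transitions are those of final color at least `m`, they all lie on cycles, and in every SCC
the least color has the parity of `m`, so that it is replaced by `m` in the next pass.

*`w` is at home in color `c(w)`.* Choose the positions `J` so sparse that, between two consecutive
positions, every run that starts in a state equivalent to that of the run on `w` sees a color
`≤ c(w)`. Suffix language invariant injections do not leave the equivalence class, so co-runs on
the resulting words `w'` still see these colors, and `c(w') ≤ c(w)`
(`exists_positions_coRunDom_le`). Either `c(w') < c(w)`, or the parity of `c(w') = c(w)` shows that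
`w` and `w'` agree on membership in the language.

*`w` is not at home in a color `j < c(w)`.* If `j` does not have the parity of `c(w)`, the trivial
injection refutes it. Otherwise, a co-run with dominating color `c(w)` eventually has only
colors `> j`, so at each later position of `J` a cycle with least color `j + 1` can be
injected. The result `w'` has a co-run with dominating color `j + 1`
(`exists_injection_coRunDom`); thus exactly one of `w` and `w'` is in the language,
and, inductively, `w'` is not at home in a color below `j`.
-/

namespace NaturalColor

open Filter

/-! ### Dominating colors -/

theorem infColors_add (ρ : ℕ → ℕ) (n : ℕ) : infColors (fun k => ρ (n + k)) = infColors ρ := by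
  ext c
  simp only [infColors, Set.mem_ofPred_eq, frequently_atTop]
  constructor
  · intro h a
    obtain ⟨b, hb, hc⟩ := h a
    exact ⟨n + b, by omega, hc⟩
  · intro h a
    obtain ⟨b, hb, hc⟩ := h (n + a)
    exact ⟨b - n, by omega, by rwa [Nat.add_sub_cancel' (by omega)]⟩

theorem isDominatingColor_add {ρ : ℕ → ℕ} (n : ℕ) {c : ℕ} :
    IsDominatingColor (fun k => ρ (n + k)) c ↔ IsDominatingColor ρ c := by
  rw [IsDominatingColor, infColors_add, IsDominatingColor]

theorem IsDominatingColor.eventually_le {ρ : ℕ → ℕ} {c : ℕ} (h : IsDominatingColor ρ c) :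
    ∀ᶠ k in atTop, c ≤ ρ k := by
  have h1 : ∀ᶠ k in atTop, ∀ d ∈ Set.Iio c, ρ k ≠ d := by
    rw [eventually_all_finite (Set.finite_Iio c)]
    intro d hd
    by_contra hn
    exact absurd (h.2 (show d ∈ infColors ρ from fun hd' => hn hd')) (not_le.2 hd)
  filter_upwards [h1] with k hk
  by_contra hlt
  exact hk (ρ k) (not_le.1 hlt) rfl

theorem exists_isDominatingColor_le {ρ : ℕ → ℕ} {b : ℕ} (h : ∃ᶠ k in atTop, ρ k ≤ b) :
    ∃ c ≤ b, IsDominatingColor ρ c := by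
  have h1 : ∃ᶠ k in atTop, ∃ d ∈ Set.Iic b, ρ k = d := h.mono fun k hk => ⟨_, hk, rfl⟩
  obtain ⟨d, hd, hf⟩ := (frequently_exists_finite (Set.finite_Iic b)).1 h1
  have hmem : d ∈ infColors ρ := hf
  exact ⟨sInf (infColors ρ), (Nat.sInf_le hmem).trans hd, Nat.sInf_mem ⟨d, hmem⟩,
    fun _ => Nat.sInf_le⟩

theorem IsDominatingColor.le_of_frequently {ρ : ℕ → ℕ} {b c : ℕ} (hc : IsDominatingColor ρ c)
    (h : ∃ᶠ k in atTop, ρ k ≤ b) : c ≤ b := by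
  obtain ⟨d, hd, hd'⟩ := exists_isDominatingColor_le h
  exact (IsLeast.unique hc hd') ▸ hd

/-- If `ρ n` is the concatenation of a nonempty block of colors `≥ m` and of `ρ (n + 1)`, and
infinitely many of these blocks contain `m`, then `m` is the dominating color. -/
theorem isDominatingColor_of_blocks {ρ : ℕ → ℕ → ℕ} {l : ℕ → ℕ} {m : ℕ} (hl : ∀ n, 0 < l n)
    (hρ : ∀ n s, ρ n (l n + s) = ρ (n + 1) s) (hge : ∀ n, ∀ s < l n, m ≤ ρ n s)
    (heq : ∀ n, ∃ n' ≥ n, ∃ s < l n', ρ n' s = m) (n : ℕ) : IsDominatingColor (ρ n) m := by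
  have hge' : ∀ s n, m ≤ ρ n s := by
    intro s
    induction s using Nat.strong_induction_on with
    | _ s ih =>
      intro n
      by_cases hs : s < l n
      · exact hge n s hs
      · have := ih (s - l n) (by have := hl n; omega) (n + 1)
        rwa [← hρ, Nat.add_sub_cancel' (not_lt.1 hs)] at this
  have hex : ∀ k n, (∃ s, ρ (n + k) s = m) → ∃ s, ρ n s = m := by
    intro k
    induction k with
    | zero => exact fun n h => h
    | succ k ih =>
      rintro n ⟨s, hs⟩
      exact ih n ⟨l (n + k) + s, by rw [hρ]; exact hs⟩
  have hfr : ∀ N n, ∃ s ≥ N, ρ n s = m := by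
    intro N
    induction N with
    | zero =>
      intro n
      obtain ⟨n', hn', s, -, hs⟩ := heq n
      obtain ⟨s', hs'⟩ := hex (n' - n) n ⟨s, by rwa [Nat.add_sub_cancel' hn']⟩
      exact ⟨s', Nat.zero_le _, hs'⟩
    | succ N ih =>
      intro n
      obtain ⟨s, hs, h⟩ := ih (n + 1)
      exact ⟨l n + s, by have := hl n; omega, by rw [hρ, h]⟩
  refine ⟨frequently_atTop.2 fun N => hfr N n, fun d hd => ?_⟩
  obtain ⟨k, rfl⟩ := Frequently.exists hd
  exact hge' k n

/-! ### Injections into infinite words -/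

section Language

variable {α : Type*}

theorem interleave_succ (w : Stream' α) (u : ℕ → List α) (n : ℕ) :
    interleave w u (n + 1) = interleave w u n ++ (w.get n :: u n) := by
  simp [interleave, List.range_succ, List.flatMap_append]

theorem le_length_interleave (w : Stream' α) (u : ℕ → List α) (n : ℕ) :
    n ≤ (interleave w u n).length := by
  induction n with
  | zero => exact Nat.zero_le _
  | succ n ih => rw [interleave_succ, List.length_append, List.length_cons]; omega

theorem interleave_of_eq_nil {w : Stream' α} {u : ℕ → List α} {n : ℕ} (h : ∀ k < n, u k = []) :
    interleave w u n = w.take n := by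
  induction n with
  | zero => rfl
  | succ n ih =>
    rw [interleave_succ, ih fun k hk => h k (by omega), h n (by omega), Stream'.take_succ']

theorem eq_append_drop_of_take_eq {w : Stream' α} {u : List α} (h : w.take u.length = u) :
    w = u ++ₛ w.drop u.length := by
  conv_lhs => rw [← Stream'.append_take_drop u.length w, h]

/-- The infinite word `w₀ u₀ w₁ u₁ …`. It is well defined since the `n`-th finite prefix has
length at least `n`. -/
theorem exists_interleave_limit (w : Stream' α) (u : ℕ → List α) :
    ∃ w' : Stream' α, ∀ n, w'.take (interleave w u n).length = interleave w u n := by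
  have hpre : ∀ n k, interleave w u n <+: interleave w u (n + k) := by
    intro n k
    induction k with
    | zero => exact List.prefix_rfl
    | succ k ih =>
      rw [← add_assoc, interleave_succ]
      exact ih.trans (List.prefix_append _ _)
  have hlt : ∀ k, k < (interleave w u (k + 1)).length := fun k => le_length_interleave w u (k + 1)
  let w' : Stream' α := fun k => (interleave w u (k + 1))[k]'(hlt k)
  refine ⟨w', fun n => ?_⟩
  apply List.ext_getElem (by simp)
  intro k h1 h2
  have h3 : ((w'.take (interleave w u n).length)[k]) = w'.get k := by
    have := Stream'.getElem?_take (s := w') h2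
    rw [List.getElem?_eq_getElem h1] at this
    exact Option.some.inj this
  rw [h3]
  show (interleave w u (k + 1))[k]'(hlt k) = _
  rcases le_total n (k + 1) with h | h
  · have hp := hpre n (k + 1 - n)
    rw [Nat.add_sub_cancel' h] at hp
    exact (hp.getElem h2).symm
  · have hp := hpre (k + 1) (n - (k + 1))
    rw [Nat.add_sub_cancel' h] at hp
    exact hp.getElem (hlt k)

namespace IsInjection

variable {L : Set (Stream' α)} {w w' : Stream' α} {J : Set ℕ} {u : ℕ → List α}

theorem drop_eq (h : IsInjection L w J u w') (n : ℕ) :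
    w'.drop (interleave w u n).length =
      (w.get n :: u n) ++ₛ w'.drop (interleave w u (n + 1)).length := by
  have h1 := eq_append_drop_of_take_eq (h.result (n + 1))
  rw [interleave_succ, Stream'.append_append_stream, ← interleave_succ] at h1
  conv_lhs => rw [h1]
  rw [Stream'.drop_append_stream]

theorem drop_eq_of_notMem (h : IsInjection L w J u w') (p l : ℕ)
    (hJ : ∀ k, p ≤ k → k < p + l → k ∉ J) :
    w'.drop (interleave w u p).length =
      (w.drop p).take l ++ₛ w'.drop (interleave w u (p + l)).length := by
  induction l with
  | zero => rfl
  | succ l ih =>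
    rw [ih fun k h1 h2 => hJ k h1 (by omega), h.drop_eq (p + l),
      h.eq_nil _ (hJ (p + l) (by omega) (by omega)), Stream'.take_succ',
      Stream'.append_append_stream, Stream'.get_drop]
    rfl

end IsInjection

/-- Injecting empty words everywhere yields the word itself. -/
theorem isInjection_self (L : Set (Stream' α)) (w : Stream' α) (J : Set ℕ) :
    IsInjection L w J (fun _ => []) w where
  eq_nil _ _ := rfl
  invariant k _ := by rw [SuffixInvariant, List.append_nil]
  result n := by rw [interleave_of_eq_nil fun _ _ => rfl, Stream'.length_take]

end Language

namespace DPA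

variable {α Q : Type*} (A : DPA α Q)

/-! ### Runs and language equivalence -/

theorem run_cons_succ (q : Q) (x : α) (z : Stream' α) (n : ℕ) :
    A.run q (Stream'.cons x z) (n + 1) = A.run (A.step q x) z n := by
  induction n with
  | zero => rfl
  | succ n ih => rw [run, ih]; rfl

theorem run_append (q : Q) (u : List α) (z : Stream' α) (n : ℕ) :
    A.run q (u ++ₛ z) (u.length + n) = A.run (u.foldl A.step q) z n := by
  induction u generalizing q with
  | nil => simp
  | cons x u ih =>
    rw [Stream'.cons_append_stream, List.length_cons, Nat.add_right_comm, run_cons_succ, ih]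
    rfl

theorem get_append (u : List α) (z : Stream' α) (n : ℕ) :
    (u ++ₛ z).get (u.length + n) = z.get n := by
  rw [← Stream'.get_drop, Stream'.drop_append_stream]

theorem runColor_append (q : Q) (u : List α) (z : Stream' α) (n : ℕ) :
    A.runColor q (u ++ₛ z) (u.length + n) = A.runColor (u.foldl A.step q) z n := by
  rw [runColor, run_append, get_append, runColor]

theorem run_eq_foldl_take (q : Q) (w : Stream' α) (n : ℕ) :
    A.run q w n = (w.take n).foldl A.step q := by
  have := A.run_append q (w.take n) (w.drop n) 0
  rwa [Stream'.append_take_drop, Stream'.length_take] at this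

theorem run_congr (q : Q) {w z : Stream' α} {n : ℕ} (h : ∀ k < n, w.get k = z.get k) :
    A.run q w n = A.run q z n := by
  induction n with
  | zero => rfl
  | succ n ih => rw [run, run, ih fun k hk => h k (by omega), h n (by omega)]

theorem runColor_append_left (q : Q) (u : List α) (z z' : Stream' α) {n : ℕ}
    (hn : n < u.length) : A.runColor q (u ++ₛ z) n = A.runColor q (u ++ₛ z') n := by
  have h : ∀ k < u.length, (u ++ₛ z).get k = (u ++ₛ z').get k := by
    intro k hk
    rw [Stream'.get_append_left _ _ _ hk, Stream'.get_append_left _ _ _ hk]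
  rw [runColor, runColor, h n hn, A.run_congr q fun k hk => h k (hk.trans hn)]

theorem mem_languageFrom_foldl (q : Q) (u : List α) (z : Stream' α) :
    z ∈ A.languageFrom (u.foldl A.step q) ↔ u ++ₛ z ∈ A.languageFrom q := by
  have h : A.runColor (u.foldl A.step q) z = fun n => A.runColor q (u ++ₛ z) (u.length + n) :=
    funext fun n => (A.runColor_append q u z n).symm
  simp only [languageFrom, Set.mem_ofPred_eq, h, isDominatingColor_add]

theorem suffixLanguage_language (u : List α) :
    suffixLanguage A.language u = A.languageFrom (u.foldl A.step A.start) :=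
  Set.ext fun z => (A.mem_languageFrom_foldl A.start u z).symm

variable {A}

theorem Equivalent.foldl {q r : Q} (h : A.Equivalent q r) (u : List α) :
    A.Equivalent (u.foldl A.step q) (u.foldl A.step r) := by
  ext z
  rw [mem_languageFrom_foldl, mem_languageFrom_foldl, show A.languageFrom q = _ from h]

theorem Equivalent.run {q r : Q} (h : A.Equivalent q r) (w : Stream' α) (n : ℕ) :
    A.Equivalent (A.run q w n) (A.run r w n) := by
  rw [run_eq_foldl_take, run_eq_foldl_take]
  exact h.foldl _

theorem run_run_drop (q : Q) (w : Stream' α) (p n : ℕ) :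
    A.run (A.run q w p) (w.drop p) n = A.run q w (p + n) := by
  have := A.run_append q (w.take p) (w.drop p) n
  rw [Stream'.append_take_drop, Stream'.length_take, ← run_eq_foldl_take] at this
  exact this.symm

theorem runColor_run_drop (q : Q) (w : Stream' α) (p n : ℕ) :
    A.runColor (A.run q w p) (w.drop p) n = A.runColor q w (p + n) := by
  rw [runColor, run_run_drop, Stream'.get_drop, runColor]

theorem exists_isDominatingColor [Finite α] [Finite Q] (q : Q) (w : Stream' α) :
    ∃ c, IsDominatingColor (A.runColor q w) c := by
  obtain ⟨b, hb⟩ := (Set.finite_range fun t : Q × α => A.color t.1 t.2).bddAbove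
  obtain ⟨c, -, hc⟩ := exists_isDominatingColor_le (ρ := A.runColor q w) (b := b)
    (Eventually.of_forall fun k => hb ⟨(A.run q w k, w.get k), rfl⟩).frequently
  exact ⟨c, hc⟩

/-- Under suffix language invariant injections, the state reached after a prefix stays in its
equivalence class. -/
theorem equivalent_foldl_interleave {w w' : Stream' α} {J : Set ℕ} {u : ℕ → List α}
    (h : IsInjection A.language w J u w') (n : ℕ) :
    A.Equivalent ((interleave w u n).foldl A.step A.start) (A.run A.start w n) := by
  induction n with
  | zero => rfl
  | succ n ih =>
    have hinv : SuffixInvariant A.language (w.take (n + 1)) (u n) := by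
      by_cases hn : n ∈ J
      · exact h.invariant n hn
      · rw [h.eq_nil n hn, SuffixInvariant, List.append_nil]
    rw [SuffixInvariant, suffixLanguage_language, suffixLanguage_language, List.foldl_append,
      ← run_eq_foldl_take] at hinv
    rw [interleave_succ, List.foldl_append, List.foldl_cons]
    exact ((ih.foldl [w.get n]).foldl (u n)).trans hinv.symm

/-! ### Dominating colors of co-runs -/

variable (A) in
/-- `d` is the dominating color of a co-run of `A` on `w`. Since finite prefixes do not matter for
the dominating color, only the part of the co-run after the change of the state is recorded. -/
def CoRunDom (w : Stream' α) (d : ℕ) : Prop :=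
  ∃ p > 0, ∃ q', A.Equivalent q' (A.run A.start w p) ∧
    IsDominatingColor (A.runColor q' (w.drop p)) d

theorem exists_isCoRun_iff (w : Stream' α) (d : ℕ) :
    (∃ π ρ, A.IsCoRun w π ρ ∧ IsDominatingColor ρ d) ↔ A.CoRunDom w d := by
  constructor
  · rintro ⟨π, ρ, ⟨p, hp, q', hq, -, -, -, hρ⟩, hd⟩
    refine ⟨p, hp, q', hq, ?_⟩
    rw [← funext hρ]
    exact (isDominatingColor_add p).2 hd
  · rintro ⟨p, hp, q', hq, hd⟩
    refine ⟨fun k => if k ≤ p then A.run A.start w k else A.run q' (w.drop p) (k - p),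
      fun k => if k < p then A.runColor A.start w k else A.runColor q' (w.drop p) (k - p),
      ⟨p, hp, q', hq, ?_, ?_, ?_, ?_⟩, ?_⟩
    · intro k hk
      simp [hk]
    · intro k hk
      simp [show k ≠ 0 by omega]
    · intro k hk
      simp [hk]
    · intro k
      simp
    · rw [← isDominatingColor_add p]
      simpa using hd

theorem CoRunDom.mem_iff {w : Stream' α} {d : ℕ} (h : A.CoRunDom w d) :
    w ∈ A.language ↔ Even d := by
  obtain ⟨p, -, q', hq, hd⟩ := h
  have h1 : w ∈ A.language ↔ w.drop p ∈ A.languageFrom q' := by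
    rw [show A.languageFrom q' = _ from hq, run_eq_foldl_take, mem_languageFrom_foldl,
      Stream'.append_take_drop, language]
  rw [h1]
  constructor
  · rintro ⟨c, hc, he⟩
    rwa [← IsLeast.unique hc hd]
  · exact fun he => ⟨d, hd, he⟩

theorem exists_isGreatest_coRunDom [Finite α] [Finite Q] (w : Stream' α) :
    ∃ c, IsGreatest {d | A.CoRunDom w d} c := by
  obtain ⟨b, hb⟩ := (Set.finite_range fun t : Q × α => A.color t.1 t.2).bddAbove
  obtain ⟨d, hd⟩ := A.exists_isDominatingColor (A.run A.start w 1) (w.drop 1)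
  have hne : {d | A.CoRunDom w d}.Nonempty := ⟨d, 1, one_pos, _, rfl, hd⟩
  have hbdd : BddAbove {d | A.CoRunDom w d} := by
    refine ⟨b, ?_⟩
    rintro d ⟨p, -, q', -, hd⟩
    exact hd.le_of_frequently
      (Eventually.of_forall fun k => hb ⟨(A.run q' (w.drop p) k, (w.drop p).get k), rfl⟩).frequently
  exact ⟨sSup {d | A.CoRunDom w d}, Nat.sSup_mem hne hbdd, fun _ h => le_csSup hbdd h⟩

/-! ### Sparse positions -/

/-- Injections at sparse positions do not raise the color of the set of co-runs, since between two
positions, every run from an equivalent state already sees a color `≤ i`. -/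
theorem exists_positions_coRunDom_le [Finite α] [Finite Q] {w : Stream' α} {i : ℕ}
    (hi : ∀ d, A.CoRunDom w d → d ≤ i) :
    ∃ J : Set ℕ, J.Infinite ∧ ∀ u w', IsInjection A.language w J u w' →
      ∀ d, A.CoRunDom w' d → d ≤ i := by
  -- After position `p > 0`, runs from equivalent states see a color `≤ i` within `l p` steps.
  have hl : ∀ p, ∃ l, 0 < p → ∀ q', A.Equivalent q' (A.run A.start w p) →
      ∃ k < l, A.runColor q' (w.drop p) k ≤ i := by
    intro p
    have h1 : ∀ q', ∃ k, 0 < p → A.Equivalent q' (A.run A.start w p) →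
        A.runColor q' (w.drop p) k ≤ i := by
      intro q'
      by_cases h : 0 < p ∧ A.Equivalent q' (A.run A.start w p)
      · obtain ⟨d, hd⟩ := A.exists_isDominatingColor q' (w.drop p)
        obtain ⟨k, hk⟩ := Frequently.exists hd.1
        exact ⟨k, fun _ _ => hk.trans_le (hi d ⟨p, h.1, q', h.2, hd⟩)⟩
      · exact ⟨0, fun h1 h2 => absurd ⟨h1, h2⟩ h⟩
    choose k hk using h1
    obtain ⟨b, hb⟩ := (Set.finite_range k).bddAbove
    exact ⟨b + 1, fun hp q' hq => ⟨k q', Nat.lt_succ_of_le (hb ⟨q', rfl⟩), hk q' hp hq⟩⟩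
  choose l hl using hl
  let j : ℕ → ℕ := fun n => Nat.rec 0 (fun _ a => a + 1 + l (a + 1)) n
  have hj : ∀ n, j (n + 1) = j n + 1 + l (j n + 1) := fun _ => rfl
  have hmono : StrictMono j := strictMono_nat_of_lt_succ fun n => by rw [hj]; omega
  refine ⟨Set.range j, Set.infinite_range_of_injective hmono.injective, ?_⟩
  rintro u w' hw' d ⟨p', hp', q', hq', hd⟩
  refine hd.le_of_frequently (frequently_atTop.2 fun N => ?_)
  -- The co-run is followed to the position right behind `p = j (p' + N) + 1` letters of `w`.
  obtain ⟨p, hpdef⟩ : ∃ p, p = j (p' + N) + 1 := ⟨_, rfl⟩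
  have hp : p' + N ≤ p := by have := hmono.id_le (p' + N); simp only [id] at this; omega
  obtain ⟨P, hP⟩ : ∃ P, P = (interleave w u p).length := ⟨_, rfl⟩
  have hPp : p ≤ P := hP ▸ le_length_interleave w u p
  have hr : A.Equivalent (A.run q' (w'.drop p') (P - p')) (A.run A.start w p) := by
    refine (hq'.run (w'.drop p') (P - p')).trans ?_
    rw [run_run_drop, Nat.add_sub_cancel' (by omega), run_eq_foldl_take, hP, hw'.result]
    exact equivalent_foldl_interleave hw' p
  obtain ⟨k, hk, hki⟩ := hl p (by omega) _ hr
  refine ⟨P - p' + k, by omega, ?_⟩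
  have hseg := hw'.drop_eq_of_notMem p (l p) (by
    rintro a h1 h2 ⟨b, rfl⟩
    have hb1 : p' + N < b := by
      by_contra hcon
      have := hmono.monotone (not_lt.1 hcon)
      omega
    have hb2 := hmono.monotone (Nat.succ_le_of_lt hb1)
    rw [Nat.succ_eq_add_one, hj, ← hpdef] at hb2
    omega)
  rw [← runColor_run_drop, Stream'.drop_drop, Nat.add_sub_cancel' (by omega), hP, hseg,
    A.runColor_append_left _ _ _ ((w.drop p).drop (l p)) (by rwa [Stream'.length_take]),
    Stream'.append_take_drop, ← hP]
  exact hki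

/-! ### Injection of cycles -/

variable (A) in
/-- The finite word `u` labels a cycle of the state `q` with least color `m`. (The colors along a
finite word are expressed as those along its infinite extensions.) -/
structure IsCycle (q : Q) (m : ℕ) (u : List α) : Prop where
  foldl_eq : u.foldl A.step q = q
  le_color : ∀ z, ∀ s < u.length, m ≤ A.runColor q (u ++ₛ z) s
  color_eq : ∀ z, ∃ s < u.length, A.runColor q (u ++ₛ z) s = m

/-- At the positions of `J` that are late enough, cycles of the states of a co-run can be injected:
they are suffix language invariant since the states of the co-run are equivalent to those of the
run. -/
theorem exists_injection_coRunDom {m i : ℕ}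
    (hcyc : ∀ q x, m ≤ A.color q x → ∃ u, A.IsCycle q m u) (hmi : m ≤ i)
    {w : Stream' α} (hw : A.CoRunDom w i) {J : Set ℕ} (hJ : J.Infinite) :
    ∃ u w', IsInjection A.language w J u w' ∧ A.CoRunDom w' m := by
  obtain ⟨p, hp, q', hq', hge⟩ : ∃ p > 0, ∃ q', A.Equivalent q' (A.run A.start w p) ∧
      ∀ k, m ≤ A.runColor q' (w.drop p) k := by
    obtain ⟨p, hp, q', hq', hd⟩ := hw
    obtain ⟨K, hK⟩ := eventually_atTop.1 hd.eventually_le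
    refine ⟨p + K, by omega, A.run q' (w.drop p) K, ?_, fun k => ?_⟩
    · rw [← run_run_drop]
      exact hq'.run _ _
    · rw [← Stream'.drop_drop, runColor_run_drop]
      exact hmi.trans (hK _ (by omega))
  -- `σ n` is the state of the co-run at position `p + n` of `w`.
  let σ : ℕ → Q := A.run q' (w.drop p)
  have hσ : ∀ n, A.Equivalent (σ n) (A.run A.start w (p + n)) := fun n => by
    rw [← run_run_drop]
    exact hq'.run _ _
  have hcyc' : ∀ n, ∃ u, A.IsCycle (σ n) m u := fun n => hcyc _ _ (hge n)
  choose v hv using hcyc'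
  classical
  let u : ℕ → List α := fun k => if k ∈ J ∧ p ≤ k then v (k + 1 - p) else []
  obtain ⟨w', hw'⟩ := exists_interleave_limit w u
  have hu : ∀ n, (u (p + n)).foldl A.step (σ (n + 1)) = σ (n + 1) := by
    intro n
    simp only [u]
    split_ifs with h
    · rw [show p + n + 1 - p = n + 1 by omega]
      exact (hv (n + 1)).foldl_eq
    · rfl
  have hinj : IsInjection A.language w J u w' := by
    refine ⟨fun k hk => if_neg fun h => hk h.1, fun k hk => ?_, hw'⟩
    by_cases hpk : p ≤ k
    · obtain ⟨n, rfl⟩ := Nat.exists_eq_add_of_le hpk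
      rw [SuffixInvariant, suffixLanguage_language, suffixLanguage_language, List.foldl_append,
        ← run_eq_foldl_take]
      have h1 := hσ (n + 1)
      have h2 := h1.foldl (u (p + n))
      rw [hu] at h2
      exact h1.symm.trans h2
    · rw [show u k = [] from if_neg fun h => hpk h.2, SuffixInvariant, List.append_nil]
  refine ⟨u, w', hinj, p, hp, q', ?_, ?_⟩
  · have htake : interleave w u p = w.take p :=
      interleave_of_eq_nil fun k hk => if_neg fun h => by omega
    have := hw' p
    rw [htake, Stream'.length_take] at this
    rwa [run_eq_foldl_take, this, ← run_eq_foldl_take]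
  · -- The blocks are the words `w_n u_n`, which lead from the state `σ (n - p)` to its successor.
    let T : ℕ → Stream' α := fun n => w'.drop (interleave w u (p + n)).length
    have hT : ∀ n, T n = (w.get (p + n) :: u (p + n)) ++ₛ T (n + 1) := fun n => hinj.drop_eq (p + n)
    have hstep : ∀ n, A.step (σ n) (w.get (p + n)) = σ (n + 1) := fun n => by
      simp only [σ, run, Stream'.get_drop]
    have hT0 : T 0 = w'.drop p := by
      simp only [T, Nat.add_zero]
      rw [interleave_of_eq_nil fun k hk => if_neg fun h => by omega, Stream'.length_take]
    have hcons : ∀ n s, A.runColor (σ n) (T n) (s + 1) =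
        A.runColor (σ (n + 1)) (u (p + n) ++ₛ T (n + 1)) s := by
      intro n s
      have h := A.runColor_append (σ n) [w.get (p + n)] (u (p + n) ++ₛ T (n + 1)) s
      rw [List.foldl_cons, List.foldl_nil, hstep, ← Stream'.append_append_stream,
        List.singleton_append, ← hT, List.length_singleton, Nat.add_comm] at h
      exact h
    rw [← hT0]
    refine isDominatingColor_of_blocks (ρ := fun n => A.runColor (σ n) (T n))
      (l := fun n => (u (p + n)).length + 1) (fun n => Nat.succ_pos _) ?_ ?_ ?_ 0
    · intro n s
      rw [Nat.add_right_comm, hcons, A.runColor_append, hu]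
    · rintro n (_ | s) hs
      · have h := hge n
        rw [runColor, Stream'.get_drop] at h
        rw [hT]
        exact h
      · rw [hcons]
        have hs' : s < (u (p + n)).length := by simpa using hs
        simp only [u] at hs' ⊢
        split_ifs at hs' ⊢ with h
        · rw [show p + n + 1 - p = n + 1 by omega] at hs' ⊢
          exact (hv (n + 1)).le_color _ s hs'
        · exact absurd hs' (Nat.not_lt_zero _)
    · intro n
      obtain ⟨k, hkJ, hk⟩ := hJ.exists_gt (p + n)
      obtain ⟨n', rfl⟩ := Nat.exists_eq_add_of_le (show p ≤ k by omega)
      have hun : u (p + n') = v (n' + 1) := by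
        simp only [u]
        rw [if_pos ⟨hkJ, by omega⟩, show p + n' + 1 - p = n' + 1 by omega]
      obtain ⟨s, hs, hm⟩ := (hv (n' + 1)).color_eq (T (n' + 1))
      refine ⟨n', by omega, s + 1, by rw [hun]; omega, ?_⟩
      rw [hcons, hun, hm]

/-! ### Cycles in streamlined automata -/

theorem Reach.exists_word {G : Set (Q × α)} {q r : Q} (h : A.Reach G q r) :
    ∃ u : List α, u.foldl A.step q = r ∧
      ∀ z, ∀ s < u.length, (A.run q (u ++ₛ z) s, (u ++ₛ z).get s) ∈ G := by
  induction h using Relation.ReflTransGen.head_induction_on with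
  | refl => exact ⟨[], rfl, fun _ _ hs => absurd hs (Nat.not_lt_zero _)⟩
  | head hab _ ih =>
    obtain ⟨x, hx, rfl⟩ := hab
    obtain ⟨u, hu, hG⟩ := ih
    refine ⟨x :: u, hu, ?_⟩
    rintro z (_ | s) hs
    · exact hx
    · rw [Stream'.cons_append_stream, run_cons_succ]
      exact hG z s (by simpa using hs)

/-- Removing the transient transitions does not destroy strong connectivity. -/
theorem Reach.diff_transient {G : Set (Q × α)} {q r : Q} (h : A.Reach G q r)
    (h' : A.Reach G r q) : A.Reach (G \ A.transient G) q r := by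
  induction h using Relation.ReflTransGen.head_induction_on with
  | refl => exact Relation.ReflTransGen.refl
  | head hab hbc ih =>
    obtain ⟨x, hx, rfl⟩ := hab
    refine Relation.ReflTransGen.head ⟨x, ⟨hx, fun ht => ht.2 (hbc.trans h')⟩, rfl⟩ ?_
    exact ih (h'.tail ⟨x, hx, rfl⟩)

section Streamlining

variable (B : DPA α Q)

theorem streamlineConfig_succ (n : ℕ) :
    B.streamlineConfig (n + 1) = B.streamlinePass (B.streamlineConfig n) :=
  Function.iterate_succ_apply' _ _ _

/-- The transitions that are colored in step (3) of a pass. -/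
def passLeast (s : StreamlineConfig α Q) : Set (Q × α) :=
  {t ∈ B.leastInSCC (s.graph \ B.transient s.graph) s.col | s.col t.1 t.2 % 2 = s.i % 2}

theorem streamlinePass_graph (s : StreamlineConfig α Q) :
    (B.streamlinePass s).graph = (s.graph \ B.transient s.graph) \ B.passLeast s := rfl

theorem streamlinePass_i_eq (s : StreamlineConfig α Q) :
    (B.streamlinePass s).i = s.i ∨
      (B.streamlinePass s).i = s.i + 1 ∧ B.passLeast s = ∅ := by
  by_cases h : (B.passLeast s).Nonempty
  · exact Or.inl (if_pos h)
  · exact Or.inr ⟨if_neg h, Set.not_nonempty_iff_eq_empty.1 h⟩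

variable {B}

theorem streamlinePass_col_of_mem {s : StreamlineConfig α Q} {t : Q × α}
    (h : t ∈ B.transient s.graph ∪ B.passLeast s) :
    (B.streamlinePass s).col t.1 t.2 = s.i := if_pos h

theorem streamlinePass_col_of_notMem {s : StreamlineConfig α Q} {t : Q × α}
    (h : t ∉ B.transient s.graph ∪ B.passLeast s) :
    (B.streamlinePass s).col t.1 t.2 = s.col t.1 t.2 := if_neg h

theorem colored_subset_graph (s : StreamlineConfig α Q) :
    B.transient s.graph ∪ B.passLeast s ⊆ s.graph := by
  rintro t (h | h)
  · exact h.1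
  · exact h.1.1.1

/-- The transitions that are removed in a pass are exactly those that are colored in it. -/
theorem mem_streamlinePass_graph {s : StreamlineConfig α Q} {t : Q × α} :
    t ∈ (B.streamlinePass s).graph ↔
      t ∈ s.graph ∧ t ∉ B.transient s.graph ∪ B.passLeast s := by
  rw [streamlinePass_graph, Set.mem_sdiff, Set.mem_sdiff, Set.mem_union]
  tauto

variable (B) in
theorem streamlineConfig_i_mono : Monotone fun n => (B.streamlineConfig n).i := by
  refine monotone_nat_of_le_succ fun n => ?_
  rw [streamlineConfig_succ]
  rcases B.streamlinePass_i_eq (B.streamlineConfig n) with h | h <;> omega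

theorem col_le_of_notMem_graph {t : Q × α} {n : ℕ} (h : t ∉ (B.streamlineConfig n).graph) :
    (B.streamlineConfig n).col t.1 t.2 ≤ (B.streamlineConfig n).i := by
  induction n with
  | zero => exact absurd (Set.mem_univ t) h
  | succ n ih =>
    have hmono := B.streamlineConfig_i_mono (Nat.le_succ n)
    simp only [Nat.succ_eq_add_one] at hmono
    refine le_trans ?_ hmono
    rw [streamlineConfig_succ] at h ⊢
    by_cases hc : t ∈ B.transient (B.streamlineConfig n).graph ∪ B.passLeast (B.streamlineConfig n)
    · exact (streamlinePass_col_of_mem hc).le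
    · rw [streamlinePass_col_of_notMem hc]
      exact ih fun ht => h (mem_streamlinePass_graph.2 ⟨ht, hc⟩)

theorem notMem_graph_and_col_eq {t : Q × α} {n n' : ℕ} (hn : n ≤ n')
    (h : t ∉ (B.streamlineConfig n).graph) :
    t ∉ (B.streamlineConfig n').graph ∧
      (B.streamlineConfig n').col t.1 t.2 = (B.streamlineConfig n).col t.1 t.2 := by
  induction n', hn using Nat.le_induction with
  | base => exact ⟨h, rfl⟩
  | succ n' _ ih =>
    rw [streamlineConfig_succ, mem_streamlinePass_graph, ← ih.2]
    exact ⟨fun ht => ih.1 ht.1,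
      streamlinePass_col_of_notMem fun hc => ih.1 (colored_subset_graph _ hc)⟩

theorem i_le_col_of_mem_graph {t : Q × α} {n n' : ℕ} (hn : n ≤ n')
    (h : t ∈ (B.streamlineConfig n).graph) (h' : t ∉ (B.streamlineConfig n').graph) :
    (B.streamlineConfig n).i ≤ (B.streamlineConfig n').col t.1 t.2 := by
  induction n', hn using Nat.le_induction with
  | base => exact absurd h h'
  | succ n' hn ih =>
    rw [streamlineConfig_succ] at h' ⊢
    by_cases hc :
        t ∈ B.transient (B.streamlineConfig n').graph ∪ B.passLeast (B.streamlineConfig n')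
    · rw [streamlinePass_col_of_mem hc]
      exact B.streamlineConfig_i_mono hn
    · rw [streamlinePass_col_of_notMem hc]
      exact ih fun ht => h' (mem_streamlinePass_graph.2 ⟨ht, hc⟩)

end Streamlining

/-- In a streamlined automaton, a transition of color at least `m ≥ 1` leaving `q` entails a cycle
through `q` with least color exactly `m`. -/
theorem IsStreamlined.exists_cycle (hA : A.IsStreamlined) {m : ℕ} (hm : 0 < m) (q : Q) (x : α)
    (hqx : m ≤ A.color q x) : ∃ u, A.IsCycle q m u := by
  obtain ⟨B, -, N, hN, rfl⟩ := hA
  obtain ⟨C, hC⟩ : ∃ C : DPA α Q, C = { B with color := (B.streamlineConfig N).col } := ⟨_, rfl⟩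
  rw [← hC] at hqx ⊢
  have hcol : ∀ t : Q × α, C.color t.1 t.2 = (B.streamlineConfig N).col t.1 t.2 := by
    subst hC; exact fun _ => rfl
  have hreach : ∀ {G q r}, B.Reach G q r → C.Reach G q r := by
    subst hC; exact fun h => h
  have hstep : C.step = B.step := by subst hC; rfl
  -- `n + 1` is the first time at which the counter is `m`.
  have hex : ∃ n, m ≤ (B.streamlineConfig n).i := by
    refine ⟨N, hqx.trans ?_⟩
    rw [hcol (q, x)]
    exact col_le_of_notMem_graph (by rw [hN]; exact Set.notMem_empty _)
  classical
  obtain ⟨n, hn⟩ : ∃ n, Nat.find hex = n + 1 := by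
    refine Nat.exists_eq_succ_of_ne_zero fun h0 => ?_
    have := Nat.find_spec hex
    rw [h0] at this
    exact absurd this (not_le.2 hm)
  have hlt : (B.streamlineConfig n).i < m := not_le.1 (Nat.find_min hex (by omega))
  have hle : m ≤ (B.streamlineConfig (n + 1)).i := hn ▸ Nat.find_spec hex
  obtain ⟨s, hs⟩ : ∃ s, s = B.streamlineConfig n := ⟨_, rfl⟩
  have hsucc : B.streamlineConfig (n + 1) = B.streamlinePass s := by
    rw [hs, streamlineConfig_succ]
  rw [← hs] at hlt
  obtain ⟨hi, hM⟩ : (B.streamlinePass s).i = m ∧ B.passLeast s = ∅ := by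
    rw [hsucc] at hle
    rcases B.streamlinePass_i_eq s with h | ⟨h, h'⟩
    · omega
    · exact ⟨by omega, h'⟩
  have hsi : s.i + 1 = m := by
    rw [hsucc] at hle
    rcases B.streamlinePass_i_eq s with h | ⟨h, h'⟩ <;> omega
  obtain ⟨G, hG⟩ : ∃ G, G = s.graph \ B.transient s.graph := ⟨_, rfl⟩
  have hgraph : (B.streamlinePass s).graph = G := by
    rw [streamlinePass_graph, hM, Set.sdiff_empty, hG]
  have hNn : n + 1 ≤ N := by
    rw [← hn]
    refine Nat.find_min' hex (hqx.trans ?_)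
    rw [hcol (q, x)]
    exact col_le_of_notMem_graph (by rw [hN]; exact Set.notMem_empty _)
  -- The transitions that remain at this time are those of final color at least `m`.
  have hge : ∀ t ∈ G, m ≤ C.color t.1 t.2 := by
    intro t ht
    rw [hcol, ← hi, ← hsucc]
    refine i_le_col_of_mem_graph hNn ?_ (by rw [hN]; exact Set.notMem_empty _)
    rwa [hsucc, hgraph]
  have hmem : ∀ t : Q × α, m ≤ C.color t.1 t.2 → t ∈ G := by
    intro t ht
    by_contra hnot
    rw [← hgraph, ← hsucc] at hnot
    rw [hcol, (notMem_graph_and_col_eq hNn hnot).2] at ht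
    rw [hsucc] at ht hnot
    by_cases hc : t ∈ B.transient s.graph ∪ B.passLeast s
    · rw [streamlinePass_col_of_mem hc] at ht
      omega
    · rw [streamlinePass_col_of_notMem hc] at ht
      have hts : t ∉ s.graph := fun h => hnot (mem_streamlinePass_graph.2 ⟨h, hc⟩)
      rw [hs] at hts hlt ht
      have := col_le_of_notMem_graph hts
      omega
  -- They lie on cycles of remaining transitions, so the next pass finds none of them transient.
  have hback : ∀ t ∈ G, B.Reach G (B.step t.1 t.2) t.1 := by
    intro t ht
    have ht' := ht
    rw [hG] at ht'
    have h1 : B.Reach s.graph (B.step t.1 t.2) t.1 := by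
      by_contra hcon
      exact ht'.2 ⟨ht'.1, hcon⟩
    rw [hG]
    exact h1.diff_transient (Relation.ReflTransGen.single ⟨t.2, ht'.1, rfl⟩)
  have htrans : B.transient G = ∅ :=
    Set.eq_empty_of_forall_notMem fun t ht => ht.2 (hback t ht.1)
  have hcolG : ∀ t ∈ G, (B.streamlinePass s).col t.1 t.2 = s.col t.1 t.2 := by
    intro t ht
    rw [← hgraph] at ht
    exact streamlinePass_col_of_notMem (mem_streamlinePass_graph.1 ht).2
  -- A transition of least color in the SCC of `q` gets color `m` in the next pass.
  have hq : (q, x) ∈ G := hmem (q, x) hqx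
  let S : Set (Q × α) := {t ∈ G | B.SameSCC G q t.1 ∧ B.SameSCC G q (B.step t.1 t.2)}
  have hqS : (q, x) ∈ S := ⟨hq, ⟨Relation.ReflTransGen.refl, Relation.ReflTransGen.refl⟩,
    Relation.ReflTransGen.single ⟨x, hq, rfl⟩, hback _ hq⟩
  obtain ⟨t, ⟨htG, ⟨hqt, htq⟩, hqt', htq'⟩, hmin⟩ :
      ∃ t ∈ S, ∀ r ∈ S, s.col t.1 t.2 ≤ s.col r.1 r.2 := by
    let f : Q × α → ℕ := fun t => s.col t.1 t.2
    have hne : (f '' S).Nonempty := ⟨_, _, hqS, rfl⟩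
    obtain ⟨t, ht, hft⟩ := Nat.sInf_mem hne
    exact ⟨t, ht, fun r hr => by
      have : sInf (f '' S) ≤ f r := Nat.sInf_le ⟨r, hr, rfl⟩
      rwa [← hft] at this⟩
  have hminG : ∀ r ∈ G, B.SameSCC G t.1 r.1 → B.SameSCC G t.1 (B.step r.1 r.2) →
      s.col t.1 t.2 ≤ s.col r.1 r.2 := fun r hr h1 h2 =>
    hmin r ⟨hr, ⟨hqt.trans h1.1, h1.2.trans htq⟩, hqt.trans h2.1, h2.2.trans htq⟩
  have htscc : B.SameSCC G t.1 (B.step t.1 t.2) := ⟨htq.trans hqt', htq'.trans hqt⟩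
  have hpar : s.col t.1 t.2 % 2 ≠ s.i % 2 := by
    intro hpar
    have : t ∈ B.passLeast s := ⟨by rw [← hG]; exact ⟨htG, htscc, hminG⟩, hpar⟩
    rw [hM] at this
    exact this
  have htm : C.color t.1 t.2 = m := by
    have hleast : t ∈ B.passLeast (B.streamlinePass s) := by
      refine ⟨?_, by rw [hcolG t htG, hi]; omega⟩
      rw [hgraph, htrans, Set.sdiff_empty]
      refine ⟨htG, htscc, fun r hr h1 h2 => ?_⟩
      rw [hcolG t htG, hcolG r hr]
      exact hminG r hr h1 h2
    have hN1 : n + 2 ≤ N := by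
      rcases hNn.lt_or_eq with h | h
      · exact h
      · rw [← h, hsucc, hgraph] at hN
        rw [hN] at htG
        exact absurd htG (Set.notMem_empty _)
    have hsucc2 : B.streamlineConfig (n + 2) = B.streamlinePass (B.streamlinePass s) := by
      rw [streamlineConfig_succ, hsucc]
    have hout : t ∉ (B.streamlineConfig (n + 2)).graph := by
      rw [hsucc2, mem_streamlinePass_graph]
      exact fun h => h.2 (Or.inr hleast)
    rw [hcol, (notMem_graph_and_col_eq hN1 hout).2, hsucc2,
      streamlinePass_col_of_mem (Or.inr hleast), hi]
  obtain ⟨u₁, hu₁, hG₁⟩ := (hreach hqt).exists_word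
  obtain ⟨u₂, hu₂, hG₂⟩ := (hreach htq').exists_word
  have hmid : ∀ z, C.runColor q ((u₁ ++ t.2 :: u₂) ++ₛ z) u₁.length = m := by
    intro z
    have h := C.runColor_append q u₁ ((t.2 :: u₂) ++ₛ z) 0
    rw [hu₁, ← Stream'.append_append_stream] at h
    exact h.trans htm
  refine ⟨u₁ ++ t.2 :: u₂, ?_, fun z k hk => ?_, fun z => ⟨u₁.length, by simp, hmid z⟩⟩
  · rw [List.foldl_append, hu₁, List.foldl_cons, hstep, ← hstep, ← hu₂, hstep]
  · rcases lt_trichotomy k u₁.length with h | rfl | h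
    · rw [Stream'.append_append_stream]
      exact hge _ (hG₁ _ k h)
    · exact (hmid z).ge
    · obtain ⟨k, rfl⟩ := Nat.exists_eq_add_of_lt h
      rw [Stream'.append_append_stream, Nat.add_assoc, C.runColor_append, hu₁, runColor,
        Stream'.cons_append_stream, run_cons_succ, hstep]
      rw [List.length_append, List.length_cons] at hk
      exact hge _ (hG₂ z k (by omega))

/-! ### Co-run colors are natural colors -/

theorem le_of_atHome (hA : A.IsStreamlined) {j : ℕ} {w : Stream' α}
    (hj : AtHome A.language j w) {d : ℕ} (hd : A.CoRunDom w d) : d ≤ j := by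
  induction j using Nat.strong_induction_on generalizing w d with
  | _ j ih =>
    by_contra! hlt
    rw [AtHome] at hj
    obtain ⟨J, hJ, hinj⟩ := hj
    by_cases hpar : Even j ↔ Even d
    · obtain ⟨u, w', hw', hd'⟩ := exists_injection_coRunDom
        (fun q x h => hA.exists_cycle (Nat.succ_pos j) q x h) hlt hd hJ
      have h1 := hd.mem_iff
      have h2 := hd'.mem_iff
      rw [Nat.succ_eq_add_one, Nat.even_add_one] at h2
      rcases hinj u w' hw' with ⟨k, hk, hhome⟩ | h | ⟨h3, h4, h5⟩
      · have := ih k hk hhome hd'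
        omega
      · tauto
      · rw [← Nat.not_even_iff_odd] at h5
        tauto
    · have h1 := hd.mem_iff
      rcases hinj _ w (isInjection_self _ _ _) with ⟨k, hk, hhome⟩ | h | ⟨h3, h4, h5⟩
      · have := ih k hk hhome hd
        omega
      · tauto
      · rw [← Nat.not_even_iff_odd] at h5
        tauto

theorem atHome_of_isGreatest [Finite α] [Finite Q] {c : ℕ} {w : Stream' α}
    (hc : IsGreatest {d | A.CoRunDom w d} c) : AtHome A.language c w := by
  induction c using Nat.strong_induction_on generalizing w with
  | _ c ih =>
    obtain ⟨J, hJ, hinj⟩ := exists_positions_coRunDom_le fun d hd => hc.2 hd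
    rw [AtHome]
    refine ⟨J, hJ, fun u w' hw' => ?_⟩
    obtain ⟨c', hc'⟩ := A.exists_isGreatest_coRunDom w'
    rcases (hinj u w' hw' c' hc'.1).lt_or_eq with h | rfl
    · exact Or.inl ⟨c', h, ih c' h hc'⟩
    · have h1 := hc.1.mem_iff
      have h2 := hc'.1.mem_iff
      rw [← Nat.not_even_iff_odd]
      tauto

end DPA

end NaturalColor

/-- The color of the set of co-runs of a word on a streamlined automaton exists, the natural color
of the word for the language of the automaton exists, and the two are equal. -/
theorem mainTheorem2 {α Q : Type*} [Finite α] [Finite Q] (A : NaturalColor.DPA α Q)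
    (hA : A.IsStreamlined) (w : Stream' α) :
    ∃ c : ℕ, A.IsCoRunColor w c ∧ NaturalColor.IsNaturalColor A.language w c := by
  obtain ⟨c, hc⟩ := A.exists_isGreatest_coRunDom w
  refine ⟨c, ?_, NaturalColor.DPA.atHome_of_isGreatest hc,
    fun j hj => NaturalColor.DPA.le_of_atHome hA hj hc.1⟩
  rw [NaturalColor.DPA.IsCoRunColor]
  simp only [NaturalColor.DPA.exists_isCoRun_iff]
  exact hc
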